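/- Let $m\ge 1$ and $N\ge 1$ be integers and let $\rho_2,\dots,\rho_N\in(-1,1)$. Let $x_{n,k},y_{n,k}$ ($1\le n\le N$, $1\le k\le m$) be independent real Gaussian random variables with mean $0$ and variance $1/2$, and put $$\hat g_{1,k}=x_{1,k}+\jmath y_{1,k},\qquad \hat g_{n,k}=\sqrt{1-\rho_n^2}\,x_{n,k}+\rho_n x_{1,k}+\jmath\big(\sqrt{1-\rho_n^2}\,y_{n,k}+\rho_n y_{1,k}\big)\quad(2\le n\le N),$$ $\hat h_n=\sum_{k=1}^m|\hat g_{n,k}|^2$. Let $E_n=\{\hat h_n>\hat h_k\text{ for all }k\ne n\}$ be the event that port $n$ is selected. Let $I_{m-1}$ be the modified Bessel function of the first kind, $Q_m(a,b)=\int_b^\infty t\,(t/a)^{m-1}e^{-(t^2+a^2)/2}I_{m-1}(at)\,dt$ the Marcum $Q$-function (with $Q_m(0,b)=\Gamma(m,b^2/2)/\Gamma(m)$), and $$\phi_n(z,x)=1-Q_m\left(\sqrt{\frac{2z\rho_n^2}{1-\rho_n^2}},\sqrt{\frac{2x}{1-\rho_n^2}}\right).$$ For $x>0$ let $$f_1(x)=\frac{1}{\Gamma(m)}e^{-x}x^{m-1}\prod_{k=2}^N\phi_k(x,x),$$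 and, for $n=2,\dots,N$, $$f_n(x)=\frac{1}{\Gamma(m)(1-\rho_n^2)}\int_0^x \exp\left(-\frac{x+z}{1-\rho_n^2}\right)\left(\frac{xz}{\rho_n^2}\right)^{\frac{m-1}{2}} I_{m-1}\left(\frac{2\sqrt{xz\rho_n^2}}{1-\rho_n^2}\right)\prod_{\substack{k=2\\k\ne n}}^N\phi_k(z,x)\,dz,$$ where for $\rho_n=0$ the product $(xz/\rho_n^2)^{(m-1)/2}I_{m-1}(\cdot)$ is read as its limit $(xz)^{m-1}/\Gamma(m)$; let $f_n(x)=0$ for $x\le 0$. Then, for every $n=1,\dots,N$, the integral defining $f_n$ (if $n\ge2$) converges for every $x>0$, the function $f_n$ is nonnegative and integrable, and it is the density of $\hat h_n$ on the event $E_n$: $\mathbb P(\hat h_n\in A,\ E_n)=\int_A f_n(x)\,dx$ for every Borel set $A\subseteq\mathbb R$. In particular $p_n:=\mathbb P(E_n)=\int_0^\infty f_n(x)\,dx$; moreover $p_n>0$, and the conditional distribution of $\hat h_n$ given $E_n$ has the density $f_n/p_n$. -/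

import Mathlib

open MeasureTheory ProbabilityTheory

open scoped ENNReal NNReal

namespace FluidAntenna

noncomputable section

/-- Modified Bessel function of the first kind, of integer order `ν ≥ 0`. -/
def besselI (ν : ℕ) (t : ℝ) : ℝ :=
  ∑' j : ℕ, (t / 2) ^ (2 * j + ν) / ((j.factorial : ℝ) * ((j + ν).factorial : ℝ))

/-- Upper incomplete gamma function `Γ(m, b)` for an integer `m ≥ 1`. -/
def upperGamma (m : ℕ) (b : ℝ) : ℝ :=
  ∫ t in Set.Ioi b, t ^ (m - 1) * Real.exp (-t)

/-- Marcum `Q`-function `Q_m(a, b)` of integer order `m ≥ 1`, for `a, b ≥ 0`. The defining integral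
has a removable singularity at `a = 0`, where the value is `Γ(m, b² / 2) / Γ(m)`. -/
def marcumQ (m : ℕ) (a b : ℝ) : ℝ :=
  if a = 0 then upperGamma m (b ^ 2 / 2) / Real.Gamma m
  else ∫ t in Set.Ioi b,
    t * (t / a) ^ (m - 1) * Real.exp (-(t ^ 2 + a ^ 2) / 2) * besselI (m - 1) (a * t)

/-- `φ(z, x) = 1 - Q_m(√(2zr²/(1-r²)), √(2x/(1-r²)))` for a port with correlation `r`. -/
def phi (m : ℕ) (r z x : ℝ) : ℝ :=
  1 - marcumQ m (Real.sqrt (2 * z * r ^ 2 / (1 - r ^ 2))) (Real.sqrt (2 * x / (1 - r ^ 2)))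

/-- The factor `(xz/r²)^((m-1)/2) I_{m-1}(2√(xzr²)/(1-r²))`; it has a removable singularity at
`r = 0`, where the value is its limit `(xz)^(m-1)/Γ(m)`. -/
def besselFactor (m : ℕ) (r z x : ℝ) : ℝ :=
  if r = 0 then (x * z) ^ (m - 1) / Real.Gamma m
  else (x * z / r ^ 2) ^ (((m : ℝ) - 1) / 2) *
    besselI (m - 1) (2 * Real.sqrt (x * z * r ^ 2) / (1 - r ^ 2))

variable {Ω : Type*} {N : ℕ} [NeZero N] {m : ℕ}

/-- The complex gain `g_{n,k}` at port `n`; the reference (first) port is `0 : Fin N`. -/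
def gain (ρ : Fin N → ℝ) (x y : Fin N → Fin m → Ω → ℝ) (n : Fin N) (k : Fin m) (ω : Ω) : ℂ :=
  if n = 0 then (x 0 k ω : ℂ) + Complex.I * (y 0 k ω : ℂ)
  else ((Real.sqrt (1 - ρ n ^ 2) * x n k ω + ρ n * x 0 k ω : ℝ) : ℂ) +
    Complex.I * ((Real.sqrt (1 - ρ n ^ 2) * y n k ω + ρ n * y 0 k ω : ℝ) : ℂ)

/-- The channel `h_n = ∑_k |g_{n,k}|²`. -/
def channel (ρ : Fin N → ℝ) (x y : Fin N → Fin m → Ω → ℝ) (n : Fin N) (ω : Ω) : ℝ :=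
  ∑ k : Fin m, ‖gain ρ x y n k ω‖ ^ 2

/-- The event that port `n` is selected, i.e. that its channel is the strongest one. -/
def selected (ρ : Fin N → ℝ) (x y : Fin N → Fin m → Ω → ℝ) (n : Fin N) : Set Ω :=
  {ω | ∀ k : Fin N, k ≠ n → channel ρ x y k ω < channel ρ x y n ω}

/-- The expression for the reference port. -/
def densityFirst (m : ℕ) (ρ : Fin N → ℝ) (x : ℝ) : ℝ :=
  1 / Real.Gamma m * Real.exp (-x) * x ^ (m - 1) *
    ∏ k ∈ Finset.univ.filter (fun k : Fin N => k ≠ 0), phi m (ρ k) x x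

/-- The integrand (in `z`) of the expression for a port `n ≠ 0`. -/
def integrandOther (m : ℕ) (ρ : Fin N → ℝ) (n : Fin N) (x z : ℝ) : ℝ :=
  Real.exp (-((x + z) / (1 - ρ n ^ 2))) * besselFactor m (ρ n) z x *
    ∏ k ∈ Finset.univ.filter (fun k : Fin N => k ≠ 0 ∧ k ≠ n), phi m (ρ k) z x

/-- The expression for a port `n ≠ 0`. -/
def densityOther (m : ℕ) (ρ : Fin N → ℝ) (n : Fin N) (x : ℝ) : ℝ :=
  1 / (Real.Gamma m * (1 - ρ n ^ 2)) * ∫ z in (0 : ℝ)..x, integrandOther m ρ n x z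

/-- The density of the channel at port `n` on the event that port `n` is selected; it vanishes off
the positive half-line. -/
def density (m : ℕ) (ρ : Fin N → ℝ) (n : Fin N) (x : ℝ) : ℝ :=
  if x ≤ 0 then 0 else if n = 0 then densityFirst m ρ x else densityOther m ρ n x

end

end FluidAntenna

open FluidAntenna

/-!
Once the Gaussian vector of the reference port is frozen, the channels of the other ports become
independent, and each is a sum of squares of `2 m` Gaussian variables with common variance
`(1 - ρ²) / 2` whose means have total square `ρ² z`, where `z` is the reference channel. Such a sum
has a scaled noncentral chi-squared law, a Poisson mixture of Gamma laws, which is recognised by its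
moment generating function. It depends on the frozen vector through `z` only; its density is the
Bessel kernel and its distribution function is `φ(z, ·)`. The event that the port is selected then
factors into distribution functions, and integrating over `z` gives the density: for the reference
port the channel is `z` itself, for another port `z` ranges over the values below the channel.
-/

namespace FluidAntenna

open Set Filter Topology

section MomentGeneratingFunction

variable {Ω Ω' : Type*} [MeasurableSpace Ω] [MeasurableSpace Ω'] {X : Ω → ℝ} {Y : Ω' → ℝ}
  {P : Measure Ω} {P' : Measure Ω'}

theorem eqOn_complexMGF_of_frequently_mgf_eq {t₀ : ℝ} (hX : t₀ ∈ interior (integrableExpSet X P))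
    (hY : t₀ ∈ interior (integrableExpSet Y P')) (h : ∃ᶠ t in 𝓝[≠] t₀, mgf X P t = mgf Y P' t) :
    EqOn (complexMGF X P) (complexMGF Y P')
      {z | z.re ∈ interior (integrableExpSet X P) ∩ interior (integrableExpSet Y P')} := by
  have hXan : AnalyticOnNhd ℂ (complexMGF X P) {z | z.re ∈ interior (integrableExpSet X P)} :=
    analyticOnNhd_complexMGF
  have hYan : AnalyticOnNhd ℂ (complexMGF Y P') {z | z.re ∈ interior (integrableExpSet Y P')} :=
    analyticOnNhd_complexMGF
  have hstrip : Convex ℝ (interior (integrableExpSet X P) ∩ interior (integrableExpSet Y P')) :=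
    convex_integrableExpSet.interior.inter convex_integrableExpSet.interior
  have hofReal : Tendsto ((↑) : ℝ → ℂ) (𝓝[≠] t₀) (𝓝[≠] (t₀ : ℂ)) :=
    Complex.continuous_ofReal.continuousWithinAt.tendsto_nhdsWithin fun t ht => by simpa using ht
  refine AnalyticOnNhd.eqOn_of_preconnected_of_frequently_eq
    (hXan.mono fun z hz => hz.1) (hYan.mono fun z hz => hz.2)
    (hstrip.linear_preimage Complex.reLm).isPreconnected (z₀ := (t₀ : ℂ)) ⟨hX, hY⟩
    (hofReal.frequently (h.mono fun t ht => ?_))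
  rw [complexMGF_ofReal, complexMGF_ofReal, ht]

theorem map_eq_map_of_mgf_eventuallyEq [IsFiniteMeasure P] [IsFiniteMeasure P']
    (hX : 0 ∈ interior (integrableExpSet X P)) (hY : 0 ∈ interior (integrableExpSet Y P'))
    (h : mgf X P =ᶠ[𝓝 0] mgf Y P') : P.map X = P'.map Y := by
  refine Measure.ext_of_charFun (funext fun t => ?_)
  rw [← complexMGF_mul_I (aemeasurable_of_mem_interior_integrableExpSet hX),
    ← complexMGF_mul_I (aemeasurable_of_mem_interior_integrableExpSet hY)]
  refine eqOn_complexMGF_of_frequently_mgf_eq hX hY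
    (h.filter_mono nhdsWithin_le_nhds).frequently ?_
  simpa using ⟨hX, hY⟩

end MomentGeneratingFunction

section Independence

theorem lintegral_pi_eq_lintegral_update {ι : Type*} [Fintype ι] [DecidableEq ι] {α : ι → Type*}
    [∀ i, MeasurableSpace (α i)] (μ : ∀ i, Measure (α i)) [∀ i, IsProbabilityMeasure (μ i)]
    (i : ι) {f : (∀ i, α i) → ℝ≥0∞} (hf : Measurable f) :
    ∫⁻ w, f w ∂Measure.pi μ = ∫⁻ u, ∫⁻ w, f (Function.update w i u) ∂Measure.pi μ ∂μ i := by
  obtain ⟨w₀⟩ := nonempty_of_isProbabilityMeasure (Measure.pi μ)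
  have hupdate (u : α i) : ∫⋯∫⁻_Finset.univ, f ∘ (Function.update · i u) ∂μ =
      ∫⋯∫⁻_Finset.univ.erase i, f ∘ (Function.update · i u) ∂μ := by
    rw [lmarginal_erase' _ (hf.comp measurable_update_left) (Finset.mem_univ i)]
    simp only [Function.comp_apply, Function.update_idem, lintegral_const, measure_univ, mul_one]
    rfl
  rw [lintegral_eq_lmarginal_univ w₀, lmarginal_erase _ hf (Finset.mem_univ i)]
  refine lintegral_congr fun u => ?_
  rw [lmarginal_update_of_notMem hf (Finset.notMem_erase i _), ← hupdate,
    ← lintegral_eq_lmarginal_univ w₀]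
  rfl

variable {Ω : Type*} [MeasurableSpace Ω] {P : Measure Ω} {ι κ : Type*}

theorem iIndepFun_curry [Countable ι] [Countable κ] {α : Type*} [MeasurableSpace α]
    {X : ι → κ → Ω → α} (hX : ∀ i j, AEMeasurable (X i j) P)
    (hindep : iIndepFun (fun p : ι × κ => X p.1 p.2) P) :
    iIndepFun (fun i ω j => X i j ω) P := by
  have := hindep.isProbabilityMeasure
  have (i : ι) (j : κ) : IsProbabilityMeasure (P.map (X i j)) :=
    Measure.isProbabilityMeasure_map (hX i j)
  have hpairs : P.map (fun ω (p : ι × κ) => X p.1 p.2 ω) =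
      Measure.infinitePi fun p : ι × κ => P.map (X p.1 p.2) :=
    hindep.map_fun_eq_infinitePi_map₀' fun p => hX p.1 p.2
  have hrow (i : ι) : P.map (fun ω j => X i j ω) = Measure.infinitePi fun j => P.map (X i j) :=
    (hindep.precomp (g := fun j => (i, j)) fun _ _ h => (Prod.ext_iff.mp h).2
      ).map_fun_eq_infinitePi_map₀' (hX i)
  rw [iIndepFun_iff_map_fun_eq_infinitePi_map₀' fun i => aemeasurable_pi_iff.mpr (hX i)]
  simp_rw [hrow]
  rw [← Measure.infinitePi_map_curry (fun i j => P.map (X i j)), ← hpairs,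
    AEMeasurable.map_map_of_aemeasurable (by fun_prop)
      (aemeasurable_pi_iff.mpr fun p : ι × κ => hX p.1 p.2)]
  rfl

theorem measure_eq_lintegral_update [Finite ι] [DecidableEq ι] {α : ι → Type*}
    [∀ i, MeasurableSpace (α i)] {X : ∀ i, Ω → α i} (hX : ∀ i, AEMeasurable (X i) P)
    (hindep : iIndepFun X P) (i : ι) {S : Set (∀ i, α i)} (hS : MeasurableSet S) :
    P {ω | (X · ω) ∈ S} = ∫⁻ u, P {ω | Function.update (X · ω) i u ∈ S} ∂P.map (X i) := by
  have := Fintype.ofFinite ι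
  have := hindep.isProbabilityMeasure
  have (j : ι) : IsProbabilityMeasure (P.map (X j)) := Measure.isProbabilityMeasure_map (hX j)
  have hlaw := hindep.hasLaw_pi fun j => ⟨hX j, rfl⟩
  have hind : Measurable (S.indicator (1 : (∀ i, α i) → ℝ≥0∞)) := measurable_one.indicator hS
  rw [hlaw.measure_eq (p := (· ∈ S)) hS]
  have := lintegral_pi_eq_lintegral_update (fun j => P.map (X j)) i hind
  rw [lintegral_indicator_one hS] at this
  refine this.trans (lintegral_congr fun u => ?_)
  have hSu := measurable_update_left (a := i) (x := u) hS
  rw [hlaw.measure_eq (p := (Function.update · i u ∈ S)) hSu]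
  exact lintegral_indicator_one hSu

variable {Y : ι → Ω → ℝ}

theorem measure_forall_lt_eq_prod (hindep : iIndepFun Y P) (hY : ∀ i, AEMeasurable (Y i) P)
    (s : Finset ι) (x : ℝ) :
    P {ω | ∀ k ∈ s, Y k ω < x} = ∏ k ∈ s, P.map (Y k) (Iio x) := by
  have hinter : {ω | ∀ k ∈ s, Y k ω < x} = ⋂ k ∈ s, Y k ⁻¹' Iio x := by
    ext ω
    simp only [mem_ofPred_eq, mem_iInter, mem_preimage, mem_Iio]
  rw [hinter, hindep.measure_inter_preimage_eq_mul s fun k _ => measurableSet_Iio]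
  exact Finset.prod_congr rfl fun k _ =>
    (Measure.map_apply_of_aemeasurable (hY k) measurableSet_Iio).symm

theorem measure_mem_and_forall_lt_eq_lintegral [Finite ι]
    (hindep : iIndepFun Y P) (hY : ∀ i, AEMeasurable (Y i) P) {i : ι} {s : Finset ι} (hi : i ∉ s)
    {A : Set ℝ} (hA : MeasurableSet A) :
    P {ω | Y i ω ∈ A ∧ ∀ k ∈ s, Y k ω < Y i ω} =
      ∫⁻ x in A, ∏ k ∈ s, P.map (Y k) (Iio x) ∂P.map (Y i) := by
  classical
  have hS : MeasurableSet {w : ι → ℝ | w i ∈ A ∧ ∀ k ∈ s, w k < w i} := by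
    measurability
  refine (measure_eq_lintegral_update hY hindep i hS).trans ?_
  rw [← lintegral_indicator hA]
  refine lintegral_congr fun x => ?_
  have hne (k : ι) (hk : k ∈ s) : k ≠ i := fun h => hi (h ▸ hk)
  by_cases hx : x ∈ A
  · rw [indicator_of_mem hx, ← measure_forall_lt_eq_prod hindep hY]
    congr 1 with ω
    simp +contextual [hx, hne]
  · simp [hx]

end Independence

section LebesgueIntegral

theorem measurable_setLIntegral {α β : Type*} [MeasurableSpace α] [MeasurableSpace β]
    {μ : Measure β} [SFinite μ] {f : α → β → ℝ≥0∞} (hf : Measurable (Function.uncurry f))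
    {s : α → Set β} (hs : MeasurableSet {p : α × β | p.2 ∈ s p.1}) :
    Measurable fun a => ∫⁻ b in s a, f a b ∂μ := by
  have hind (a : α) : ∫⁻ b in s a, f a b ∂μ =
      ∫⁻ b, {p : α × β | p.2 ∈ s p.1}.indicator (Function.uncurry f) (a, b) ∂μ :=
    (lintegral_indicator (measurable_prodMk_left hs) (f a)).symm
  simp_rw [hind]
  exact (hf.indicator hs).lintegral_prod_right'

theorem lintegral_inter_Ioi_swap {μ ν : Measure ℝ} [SFinite μ] [SFinite ν] {f : ℝ → ℝ → ℝ≥0∞}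
    (hf : Measurable (Function.uncurry f)) (A : Set ℝ) :
    ∫⁻ z, ∫⁻ x in A ∩ Ioi z, f z x ∂ν ∂μ = ∫⁻ x in A, ∫⁻ z in Iio x, f z x ∂μ ∂ν := by
  have hind (z : ℝ) : ∫⁻ x in A ∩ Ioi z, f z x ∂ν =
      ∫⁻ x in A, {p : ℝ × ℝ | p.1 < p.2}.indicator (Function.uncurry f) (z, x) ∂ν := by
    rw [inter_comm, ← Measure.restrict_restrict measurableSet_Ioi]
    exact (lintegral_indicator measurableSet_Ioi (f z)).symm
  simp_rw [hind]
  rw [lintegral_lintegral_swap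
    (f := fun z x => {p : ℝ × ℝ | p.1 < p.2}.indicator (Function.uncurry f) (z, x))
    (hf.indicator (measurableSet_lt measurable_fst measurable_snd)).aemeasurable]
  exact lintegral_congr fun x => lintegral_indicator measurableSet_Iio (f · x)

theorem integral_mul_comp_sq_Ioi (g : ℝ → ℝ) {b c : ℝ} (hb : 0 ≤ b) (hc : 0 < c) :
    ∫ t in Ioi b, 2 * c * t * g (c * t ^ 2) = ∫ v in Ioi (c * b ^ 2), g v := by
  have hsq := integral_comp_rpow_Ioi_of_pos' (g := fun v => g (c * v)) two_pos (sq_nonneg b)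
  have hsqrt : (b ^ 2) ^ (2 : ℝ)⁻¹ = b := by
    rw [← Real.rpow_natCast, Nat.cast_ofNat, Real.rpow_rpow_inv hb two_ne_zero]
  rw [hsqrt, integral_comp_mul_left_Ioi g _ hc, eq_inv_smul_iff₀ hc.ne', ← integral_smul] at hsq
  rw [← hsq]
  refine integral_congr_ae (ae_of_all _ fun t => ?_)
  norm_num
  ring

end LebesgueIntegral

section WithDensity

variable {α Ω : Type*} [MeasurableSpace α] [MeasurableSpace Ω] {μ : Measure α} {P : Measure Ω}
  {X : Ω → α} {s : Set Ω}

theorem withDensity_ofReal_toReal {g : α → ℝ≥0∞} (hg : AEMeasurable g μ)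
    (hfin : ∫⁻ a, g a ∂μ ≠ ∞) :
    μ.withDensity (fun a => ENNReal.ofReal (g a).toReal) = μ.withDensity g :=
  withDensity_congr_ae ((ae_lt_top' hg hfin).mono fun _ ha => ENNReal.ofReal_toReal ha.ne)

theorem lintegral_eq_of_map_restrict_eq_withDensity {g : α → ℝ≥0∞} (hX : AEMeasurable X P)
    (hmap : (P.restrict s).map X = μ.withDensity g) : ∫⁻ a, g a ∂μ = P s := by
  rw [← setLIntegral_univ, ← withDensity_apply _ .univ, ← hmap,
    Measure.map_apply_of_aemeasurable hX.restrict .univ, preimage_univ, Measure.restrict_apply_univ]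

theorem map_cond_eq_withDensity {f : α → ℝ} (hf : Measurable f)
    (hmap : (P.restrict s).map X = μ.withDensity fun a => ENNReal.ofReal (f a))
    (hs : 0 < P.real s) :
    (ProbabilityTheory.cond P s).map X =
      μ.withDensity fun a => ENNReal.ofReal (f a / P.real s) := by
  have hfin : P s ≠ ∞ := fun h => hs.ne' (by simp [measureReal_def, h])
  rw [ProbabilityTheory.cond, Measure.map_smul, hmap, ← withDensity_smul _ hf.ennreal_ofReal]
  congr 1 with a
  rw [Pi.smul_apply, smul_eq_mul, ENNReal.ofReal_div_of_pos hs, ofReal_measureReal hfin,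
    ENNReal.div_eq_inv_mul]

end WithDensity

noncomputable section

section BesselSeries

/-- The entire function `w ↦ ∑ j, w ^ j / (j! (j + ν)!)`, which is `I_ν` stripped of its power
factor: `I_ν(t) = (t / 2) ^ ν * besselSeries ν (t ^ 2 / 4)`. -/
def besselSeries (ν : ℕ) (w : ℝ) : ℝ :=
  ∑' j : ℕ, w ^ j / (j.factorial * (j + ν).factorial)

theorem summable_besselSeries (ν : ℕ) (w : ℝ) :
    Summable fun j : ℕ => w ^ j / ((j.factorial : ℝ) * (j + ν).factorial) := by
  refine .of_norm_bounded (Real.summable_pow_div_factorial |w|) fun j => ?_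
  have hfac : (1 : ℝ) ≤ (j + ν).factorial := by exact_mod_cast (j + ν).factorial_pos
  rw [norm_div, norm_pow, Real.norm_eq_abs, Real.norm_of_nonneg (by positivity)]
  gcongr
  exact le_mul_of_one_le_right (by positivity) hfac

theorem besselI_eq (ν : ℕ) (t : ℝ) :
    besselI ν t = (t / 2) ^ ν * besselSeries ν (t ^ 2 / 4) := by
  rw [besselI, besselSeries, ← tsum_mul_left]
  refine tsum_congr fun j => ?_
  rw [pow_add, pow_mul, div_pow t 2 2]
  norm_num
  ring

theorem besselSeries_zero (ν : ℕ) : besselSeries ν 0 = (ν.factorial : ℝ)⁻¹ := by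
  rw [besselSeries, tsum_eq_single 0 fun j hj => by simp [hj]]
  simp

theorem besselSeries_pos (ν : ℕ) {w : ℝ} (hw : 0 ≤ w) : 0 < besselSeries ν w :=
  (summable_besselSeries ν w).tsum_pos (fun j => by positivity) 0 (by positivity)

theorem monotoneOn_besselSeries (ν : ℕ) : MonotoneOn (besselSeries ν) (Ici 0) := by
  intro w₁ (hw₁ : 0 ≤ w₁) w₂ _ h
  exact (summable_besselSeries ν w₁).tsum_le_tsum (fun j => by gcongr) (summable_besselSeries ν w₂)

@[fun_prop]
theorem measurable_besselSeries (ν : ℕ) : Measurable (besselSeries ν) :=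
  measurable_of_tendsto_metrizable
    (f := fun n w => ∑ j ∈ Finset.range n, w ^ j / ((j.factorial : ℝ) * (j + ν).factorial))
    (fun n => by fun_prop)
    (tendsto_pi_nhds.mpr fun w => (summable_besselSeries ν w).hasSum.tendsto_sum_nat)

end BesselSeries

section Noncentral

/-- The density of a scaled noncentral chi-squared law: that of `∑ i, X i ^ 2` for `2 (ν + 1)`
independent Gaussian variables `X i` with means `a i` and common variance `s / 2`, where
`l = ∑ i, a i ^ 2`. -/
def noncentralPDF (ν : ℕ) (s l x : ℝ) : ℝ :=
  if 0 < x then (x / s) ^ ν / s * Real.exp (-(x + l) / s) * besselSeries ν (l * x / s ^ 2) else 0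

/-- The scaled noncentral chi-squared law with density `noncentralPDF ν s l`. -/
def noncentralLaw (ν : ℕ) (s l : ℝ) : Measure ℝ :=
  volume.withDensity fun x => ENNReal.ofReal (noncentralPDF ν s l x)

theorem noncentralPDF_of_pos (ν : ℕ) (s l : ℝ) {x : ℝ} (hx : 0 < x) :
    noncentralPDF ν s l x =
      (x / s) ^ ν / s * Real.exp (-(x + l) / s) * besselSeries ν (l * x / s ^ 2) :=
  if_pos hx

theorem noncentralPDF_of_nonpos (ν : ℕ) (s l : ℝ) {x : ℝ} (hx : x ≤ 0) :
    noncentralPDF ν s l x = 0 :=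
  if_neg hx.not_gt

theorem noncentralPDF_pos (ν : ℕ) {s l x : ℝ} (hs : 0 < s) (hl : 0 ≤ l) (hx : 0 < x) :
    0 < noncentralPDF ν s l x := by
  have := besselSeries_pos ν (w := l * x / s ^ 2) (by positivity)
  rw [noncentralPDF_of_pos ν s l hx]
  positivity

theorem noncentralPDF_nonneg (ν : ℕ) {s l : ℝ} (hs : 0 < s) (hl : 0 ≤ l) (x : ℝ) :
    0 ≤ noncentralPDF ν s l x := by
  rcases le_or_gt x 0 with hx | hx
  · exact (noncentralPDF_of_nonpos ν s l hx).ge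
  · exact (noncentralPDF_pos ν hs hl hx).le

@[fun_prop]
theorem measurable_noncentralPDF {α : Type*} [MeasurableSpace α] (ν : ℕ) (s : ℝ) {f g : α → ℝ}
    (hf : Measurable f) (hg : Measurable g) : Measurable fun a => noncentralPDF ν s (f a) (g a) :=
  Measurable.ite (measurableSet_lt measurable_const hg) (by fun_prop) measurable_const

theorem hasSum_noncentralPDF (ν : ℕ) {s l x : ℝ} (hs : 0 < s) (hx : x ≠ 0) :
    HasSum (fun j : ℕ => Real.exp (-(l / s)) * (l / s) ^ j / j.factorial *
      gammaPDFReal (j + ν + 1) s⁻¹ x) (noncentralPDF ν s l x) := by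
  rcases hx.lt_or_gt with hx | hx
  · simp [noncentralPDF_of_nonpos ν s l hx.le, gammaPDFReal, hx.not_ge, hasSum_zero]
  have hexp : Real.exp (-(x + l) / s) = Real.exp (-(l / s)) * Real.exp (-(s⁻¹ * x)) := by
    rw [← Real.exp_add]
    ring_nf
  have hgamma (j : ℕ) : gammaPDFReal (j + ν + 1) s⁻¹ x =
      s⁻¹ ^ (j + ν + 1) / (j + ν).factorial * x ^ (j + ν) * Real.exp (-(s⁻¹ * x)) := by
    rw [gammaPDFReal, if_pos hx.le, add_sub_cancel_right]
    norm_cast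
    rw [Nat.cast_succ, Real.Gamma_nat_eq_factorial]
  rw [noncentralPDF_of_pos ν s l hx, hexp]
  convert! (summable_besselSeries ν (l * x / s ^ 2)).hasSum.mul_left _ using 2 with j
  rw [hgamma, div_pow, div_pow, div_pow, mul_pow, inv_pow]
  field_simp
  ring

theorem noncentralLaw_eq_sum_gammaMeasure (ν : ℕ) {s l : ℝ} (hs : 0 < s) (hl : 0 ≤ l) :
    noncentralLaw ν s l = Measure.sum fun j : ℕ =>
      ENNReal.ofReal (Real.exp (-(l / s)) * (l / s) ^ j / j.factorial) •
        gammaMeasure (j + ν + 1) s⁻¹ := by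
  have hpdf (a : ℝ) : Measurable (gammaPDF a s⁻¹) := by unfold gammaPDF; fun_prop
  simp_rw [gammaMeasure, ← withDensity_smul _ (hpdf _)]
  rw [← withDensity_tsum fun j => (hpdf _).const_smul _, noncentralLaw]
  refine withDensity_congr_ae ?_
  filter_upwards [Measure.ae_ne volume 0] with x hx
  have hsum := hasSum_noncentralPDF ν (l := l) hs hx
  have hgamma (j : ℕ) := gammaPDFReal_nonneg (a := j + ν + 1) (by positivity) (inv_pos.mpr hs) x
  rw [← hsum.tsum_eq, ENNReal.ofReal_tsum_of_nonneg
    (fun j => mul_nonneg (by positivity) (hgamma j)) hsum.summable, ENNReal.tsum_apply]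
  exact tsum_congr fun j => ENNReal.ofReal_mul (by positivity)

theorem lintegral_exp_mul_gammaMeasure {a r t : ℝ} (ha : 0 < a) (hr : 0 < r) (ht : t < r) :
    ∫⁻ x, ENNReal.ofReal (Real.exp (t * x)) ∂gammaMeasure a r =
      ENNReal.ofReal ((r / (r - t)) ^ a) := by
  have hrt : 0 < r - t := sub_pos.mpr ht
  have htilt (x : ℝ) : gammaPDF a r x * ENNReal.ofReal (Real.exp (t * x)) =
      ENNReal.ofReal ((r / (r - t)) ^ a) * gammaPDF a (r - t) x := by
    rw [gammaPDF, gammaPDF, ← ENNReal.ofReal_mul (gammaPDFReal_nonneg ha hr x),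
      ← ENNReal.ofReal_mul (by positivity), gammaPDFReal, gammaPDFReal]
    split_ifs
    · have hexp : Real.exp (-((r - t) * x)) = Real.exp (t * x) * Real.exp (-(r * x)) := by
        rw [← Real.exp_add]
        ring_nf
      rw [hexp, Real.div_rpow hr.le hrt.le]
      field_simp
    · simp
  rw [gammaMeasure, lintegral_withDensity_eq_lintegral_mul _ (by unfold gammaPDF; fun_prop)
    (by fun_prop)]
  simp_rw [Pi.mul_apply, htilt]
  rw [lintegral_const_mul' _ _ ENNReal.ofReal_ne_top, lintegral_gammaPDF_eq_one ha hrt, mul_one]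

theorem hasSum_poisson_mul_pow (q c : ℝ) (k : ℕ) :
    HasSum (fun j : ℕ => Real.exp (-q) * q ^ j / j.factorial * c ^ (j + k))
      (c ^ k * Real.exp (q * c - q)) := by
  have hexp : HasSum (fun j : ℕ => (q * c) ^ j / (j.factorial : ℝ)) (Real.exp (q * c)) := by
    simpa only [Real.exp_eq_exp_ℝ] using NormedSpace.expSeries_div_hasSum_exp (q * c)
  rw [sub_eq_add_neg, Real.exp_add, mul_comm (Real.exp _), ← mul_assoc]
  convert! hexp.mul_left (c ^ k * Real.exp (-q)) using 2 with j
  ring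

theorem lintegral_exp_mul_noncentralLaw (ν : ℕ) {s l t : ℝ} (hs : 0 < s) (hl : 0 ≤ l)
    (ht : s * t < 1) :
    ∫⁻ x, ENNReal.ofReal (Real.exp (t * x)) ∂noncentralLaw ν s l =
      ENNReal.ofReal ((1 - s * t)⁻¹ ^ (ν + 1) * Real.exp (t * l / (1 - s * t))) := by
  have hst : 0 < 1 - s * t := sub_pos.mpr ht
  have hts : t < s⁻¹ := by rwa [← one_div, lt_div_iff₀' hs]
  have hratio : s⁻¹ / (s⁻¹ - t) = (1 - s * t)⁻¹ := by
    field_simp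
  have hcomponent (j : ℕ) : ENNReal.ofReal (Real.exp (-(l / s)) * (l / s) ^ j / j.factorial) *
      ∫⁻ x, ENNReal.ofReal (Real.exp (t * x)) ∂gammaMeasure (j + ν + 1) s⁻¹ =
      ENNReal.ofReal (Real.exp (-(l / s)) * (l / s) ^ j / j.factorial *
        (1 - s * t)⁻¹ ^ (j + (ν + 1))) := by
    rw [lintegral_exp_mul_gammaMeasure (by positivity) (inv_pos.mpr hs) hts, hratio,
      ENNReal.ofReal_mul (by positivity), ← Real.rpow_natCast _ (j + (ν + 1))]
    push_cast
    rw [add_assoc]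
  have hsum := hasSum_poisson_mul_pow (l / s) (1 - s * t)⁻¹ (ν + 1)
  rw [noncentralLaw_eq_sum_gammaMeasure ν hs hl, lintegral_sum_measure]
  simp_rw [lintegral_smul_measure, smul_eq_mul, hcomponent]
  rw [← ENNReal.ofReal_tsum_of_nonneg (fun j => by positivity) hsum.summable, hsum.tsum_eq]
  congr 3
  field_simp
  ring

theorem isProbabilityMeasure_noncentralLaw (ν : ℕ) {s l : ℝ} (hs : 0 < s) (hl : 0 ≤ l) :
    IsProbabilityMeasure (noncentralLaw ν s l) :=
  ⟨by simpa using lintegral_exp_mul_noncentralLaw ν hs hl (t := 0) (by simp)⟩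

theorem mgf_noncentralLaw (ν : ℕ) {s l t : ℝ} (hs : 0 < s) (hl : 0 ≤ l) (ht : s * t < 1) :
    mgf id (noncentralLaw ν s l) t =
      (1 - s * t)⁻¹ ^ (ν + 1) * Real.exp (t * l / (1 - s * t)) := by
  have : 0 < 1 - s * t := sub_pos.mpr ht
  simp only [mgf, id]
  rw [integral_eq_lintegral_of_nonneg_ae (ae_of_all _ fun x => (Real.exp_pos _).le) (by fun_prop),
    lintegral_exp_mul_noncentralLaw ν hs hl ht, ENNReal.toReal_ofReal (by positivity)]

end Noncentral

section GaussianSquares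

theorem gaussianPDFReal_mul_exp_sq (a : ℝ) {v w : ℝ≥0} {t : ℝ} (hv : v ≠ 0) (ht : 2 * v * t < 1)
    (hw : (w : ℝ) = v / (1 - 2 * v * t)) (x : ℝ) :
    gaussianPDFReal a v x * Real.exp (t * x ^ 2) =
      Real.sqrt (1 - 2 * v * t)⁻¹ * Real.exp (t * a ^ 2 / (1 - 2 * v * t)) *
        gaussianPDFReal (a / (1 - 2 * v * t)) w x := by
  have hpos : 0 < 1 - 2 * v * t := sub_pos.mpr ht
  have : (0 : ℝ) < v := by positivity
  have hsqrt : (Real.sqrt (2 * Real.pi * v))⁻¹ = Real.sqrt (1 - 2 * v * t)⁻¹ *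
      (Real.sqrt (2 * Real.pi * (v / (1 - 2 * v * t))))⁻¹ := by
    rw [← Real.sqrt_inv, ← Real.sqrt_inv, ← Real.sqrt_mul (by positivity)]
    congr 1
    field_simp
  simp only [gaussianPDFReal, hw]
  rw [hsqrt, mul_assoc, ← Real.exp_add, mul_mul_mul_comm, ← Real.exp_add]
  congr 2
  field_simp
  ring

theorem mgf_sq_gaussianReal (a : ℝ) {v : ℝ≥0} {t : ℝ} (hv : v ≠ 0) (ht : 2 * v * t < 1) :
    mgf (fun x => x ^ 2) (gaussianReal a v) t =
      Real.sqrt (1 - 2 * v * t)⁻¹ * Real.exp (t * a ^ 2 / (1 - 2 * v * t)) := by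
  have : 0 < 1 - 2 * v * t := sub_pos.mpr ht
  have hw : 0 < v / (1 - 2 * v * t) := by positivity
  rw [mgf, integral_gaussianReal_eq_integral_smul hv]
  simp only [smul_eq_mul,
    gaussianPDFReal_mul_exp_sq a hv ht (Real.coe_toNNReal _ hw.le)]
  rw [integral_const_mul, integral_gaussianPDFReal_eq_one _ (by simpa using hw), mul_one]

variable {Ω ι : Type*} [MeasurableSpace Ω] [Fintype ι] {P : Measure Ω} {X : ι → Ω → ℝ} {a : ι → ℝ}
  {v : ℝ≥0}

theorem mgf_sum_sq (hindep : iIndepFun X P)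
    (hX : ∀ i, HasLaw (X i) (gaussianReal (a i) v) P) (hv : v ≠ 0) {t : ℝ} (ht : 2 * v * t < 1) :
    mgf (fun ω => ∑ i, X i ω ^ 2) P t = Real.sqrt (1 - 2 * v * t)⁻¹ ^ Fintype.card ι *
      Real.exp (t * (∑ i, a i ^ 2) / (1 - 2 * v * t)) := by
  have hone (i : ι) : mgf ((fun x => x ^ 2) ∘ X i) P t =
      Real.sqrt (1 - 2 * v * t)⁻¹ * Real.exp (t * a i ^ 2 / (1 - 2 * v * t)) := by
    rw [← mgf_sq_gaussianReal (a i) hv ht, ← (hX i).map_eq]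
    exact (mgf_map (hX i).aemeasurable (by fun_prop)).symm
  have hsum : (fun ω => ∑ i, X i ω ^ 2) = ∑ i, (fun x : ℝ => x ^ 2) ∘ X i := by
    ext ω
    simp
  rw [hsum, (hindep.comp (fun _ x => x ^ 2) fun _ => by fun_prop).mgf_sum₀
    fun i => (hX i).aemeasurable.pow_const 2]
  simp_rw [hone]
  rw [Finset.prod_mul_distrib, Finset.prod_const, Finset.card_univ, ← Real.exp_sum,
    ← Finset.sum_div, ← Finset.mul_sum]

theorem hasLaw_sum_sq (hindep : iIndepFun X P)
    (hX : ∀ i, HasLaw (X i) (gaussianReal (a i) v) P) (hv : v ≠ 0) {ν : ℕ}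
    (hι : Fintype.card ι = 2 * (ν + 1)) :
    HasLaw (fun ω => ∑ i, X i ω ^ 2) (noncentralLaw ν (2 * v) (∑ i, a i ^ 2)) P := by
  have hs : (0 : ℝ) < 2 * v := by positivity
  have hl : 0 ≤ ∑ i, a i ^ 2 := Finset.sum_nonneg fun i _ => sq_nonneg _
  have := isProbabilityMeasure_noncentralLaw ν hs hl
  have := hindep.isProbabilityMeasure
  have hnear : ∀ᶠ t : ℝ in 𝓝 0, 2 * v * t < 1 :=
    ContinuousAt.eventually_lt (by fun_prop) (by fun_prop) (by simp)
  have hmgf : ∀ᶠ t : ℝ in 𝓝 0, mgf (fun ω => ∑ i, X i ω ^ 2) P t =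
      mgf id (noncentralLaw ν (2 * v) (∑ i, a i ^ 2)) t ∧
      0 < mgf id (noncentralLaw ν (2 * v) (∑ i, a i ^ 2)) t := by
    filter_upwards [hnear] with t ht
    have : 0 < 1 - 2 * v * t := sub_pos.mpr ht
    rw [mgf_sum_sq hindep hX hv ht, mgf_noncentralLaw ν hs hl ht, hι, pow_mul,
      Real.sq_sqrt (by positivity)]
    exact ⟨rfl, by positivity⟩
  refine ⟨Finset.aemeasurable_fun_sum _ fun i _ => (hX i).aemeasurable.pow_const 2, ?_⟩
  rw [← Measure.map_id (μ := noncentralLaw _ _ _)]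
  refine map_eq_map_of_mgf_eventuallyEq (mem_interior_iff_mem_nhds.mpr ?_)
    (mem_interior_iff_mem_nhds.mpr ?_) (hmgf.mono fun t ht => ht.1)
  · exact hmgf.mono fun t ht => mgf_pos_iff.mp (ht.1 ▸ ht.2)
  · exact hmgf.mono fun t ht => mgf_pos_iff.mp ht.2

end GaussianSquares

section NoncentralCDF

variable {ν : ℕ} {s l x : ℝ}

theorem noncentralLaw_Iio_pos (hs : 0 < s) (hl : 0 ≤ l) (hx : 0 < x) :
    0 < noncentralLaw ν s l (Iio x) := by
  rw [noncentralLaw, withDensity_apply _ measurableSet_Iio,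
    setLIntegral_pos_iff (by fun_prop)]
  refine (by simpa using hx : 0 < volume (Ioo 0 x)).trans_le (measure_mono fun v hv => ⟨?_, hv.2⟩)
  exact (ENNReal.ofReal_pos.mpr (noncentralPDF_pos ν hs hl hv.1)).ne'

@[fun_prop]
theorem measurable_noncentralLaw_Iio {α : Type*} [MeasurableSpace α] (ν : ℕ) (s : ℝ) {f g : α → ℝ}
    (hf : Measurable f) (hg : Measurable g) :
    Measurable fun a => noncentralLaw ν s (f a) (Iio (g a)) := by
  simp only [noncentralLaw, withDensity_apply _ measurableSet_Iio]
  exact measurable_setLIntegral (by fun_prop)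
    (measurableSet_lt measurable_snd (hg.comp measurable_fst))

theorem noncentralPDF_le {L : ℝ} (hs : 0 < s) (hl : 0 ≤ l) (hL : l ≤ L) (hx : 0 < x) :
    noncentralPDF ν s l x ≤ (x / s) ^ ν / s * besselSeries ν (L * x / s ^ 2) := by
  have hexp : Real.exp (-(x + l) / s) ≤ 1 :=
    Real.exp_le_one_iff.mpr (div_nonpos_of_nonpos_of_nonneg (by linarith) hs.le)
  have hseries : besselSeries ν (l * x / s ^ 2) ≤ besselSeries ν (L * x / s ^ 2) :=
    monotoneOn_besselSeries ν (mem_Ici.mpr (by positivity))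
      (mem_Ici.mpr (by have := hl.trans hL; positivity)) (by gcongr)
  have hnonneg := (besselSeries_pos ν (w := l * x / s ^ 2) (by positivity)).le
  rw [noncentralPDF_of_pos ν s l hx]
  calc _ ≤ (x / s) ^ ν / s * 1 * besselSeries ν (L * x / s ^ 2) := by gcongr
    _ = _ := by rw [mul_one]

end NoncentralCDF

section SpecialFunctions

variable {ν : ℕ} {r s z x : ℝ}

theorem besselFactor_eq (hr : r ^ 2 < 1) (hxz : 0 ≤ x * z) :
    besselFactor (ν + 1) r z x =
      (x * z / (1 - r ^ 2)) ^ ν * besselSeries ν (r ^ 2 * z * x / (1 - r ^ 2) ^ 2) := by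
  have hs : 0 < 1 - r ^ 2 := sub_pos.mpr hr
  unfold besselFactor
  rw [mul_assoc (r ^ 2), mul_comm z, mul_comm (r ^ 2)]
  generalize x * z = p at hxz ⊢
  rcases eq_or_ne r 0 with rfl | hr0
  · simp [besselSeries_zero, Real.Gamma_nat_eq_factorial, div_eq_mul_inv]
  have hpow : (p / r ^ 2) ^ ((((ν + 1 : ℕ) : ℝ) - 1) / 2) = Real.sqrt (p / r ^ 2) ^ ν := by
    rw [Real.sqrt_eq_rpow, ← Real.rpow_natCast _ ν, ← Real.rpow_mul (by positivity)]
    congr 1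
    push_cast
    ring
  have hsq : (2 * Real.sqrt (p * r ^ 2) / (1 - r ^ 2)) ^ 2 / 4 = p * r ^ 2 / (1 - r ^ 2) ^ 2 := by
    rw [div_pow, mul_pow, Real.sq_sqrt (by positivity)]
    ring
  have hbase : Real.sqrt (p / r ^ 2) * (2 * Real.sqrt (p * r ^ 2) / (1 - r ^ 2) / 2) =
      p / (1 - r ^ 2) := by
    have hprod : Real.sqrt (p / r ^ 2) * Real.sqrt (p * r ^ 2) = p := by
      rw [← Real.sqrt_mul (by positivity), show p / r ^ 2 * (p * r ^ 2) = p ^ 2 by field_simp,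
        Real.sqrt_sq hxz]
    linear_combination hprod / (1 - r ^ 2)
  rw [if_neg hr0, hpow, Nat.add_sub_cancel, besselI_eq, hsq, ← mul_assoc, ← mul_pow, hbase]

theorem noncentralPDF_mul_eq (hr : r ^ 2 < 1) (hz : 0 < z) (hx : 0 < x) :
    noncentralPDF ν 1 0 z * noncentralPDF ν (1 - r ^ 2) (r ^ 2 * z) x =
      1 / (Real.Gamma (ν + 1 : ℕ) * (1 - r ^ 2)) *
        (Real.exp (-((x + z) / (1 - r ^ 2))) * besselFactor (ν + 1) r z x) := by
  have hs : 0 < 1 - r ^ 2 := sub_pos.mpr hr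
  have hexp : Real.exp (-(z + 0) / 1) * Real.exp (-(x + r ^ 2 * z) / (1 - r ^ 2)) =
      Real.exp (-((x + z) / (1 - r ^ 2))) := by
    rw [← Real.exp_add]
    congr 1
    field_simp
    ring
  rw [noncentralPDF_of_pos _ _ _ hz, noncentralPDF_of_pos _ _ _ hx, ← hexp,
    besselFactor_eq hr (by positivity), zero_mul, zero_div, besselSeries_zero, Nat.cast_succ,
    Real.Gamma_nat_eq_factorial, div_pow x, div_pow (x * z), mul_pow]
  field_simp

theorem noncentralPDF_one_zero (hx : 0 < x) :
    noncentralPDF ν 1 0 x = 1 / Real.Gamma (ν + 1 : ℕ) * Real.exp (-x) * x ^ ν := by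
  rw [noncentralPDF_of_pos _ _ _ hx, zero_mul, zero_div, besselSeries_zero, Nat.cast_succ,
    Real.Gamma_nat_eq_factorial, add_zero, div_one, div_one, div_one]
  ring

theorem marcumQ_eq_integral_noncentralPDF (a : ℝ) {b : ℝ} (hs : 0 < s) (hb : 0 ≤ b) :
    marcumQ (ν + 1) a b =
      ∫ v in Ioi (s / 2 * b ^ 2), noncentralPDF ν s (s / 2 * a ^ 2) v := by
  unfold marcumQ
  split_ifs with ha
  · have hscale := integral_comp_mul_left_Ioi (noncentralPDF ν s (s / 2 * a ^ 2)) (b ^ 2 / 2) hs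
    rw [eq_inv_smul_iff₀ hs.ne', ← integral_smul] at hscale
    rw [show s / 2 * b ^ 2 = s * (b ^ 2 / 2) by ring, ← hscale, upperGamma, ← integral_div]
    refine setIntegral_congr_fun measurableSet_Ioi fun v hv => ?_
    have hv0 : 0 < v := (by positivity : 0 ≤ b ^ 2 / 2).trans_lt hv
    simp only [noncentralPDF_of_pos _ _ _ (mul_pos hs hv0), ha, zero_pow two_ne_zero, mul_zero,
      zero_mul, zero_div, add_zero, besselSeries_zero, Nat.cast_succ, Nat.add_sub_cancel,
      Real.Gamma_nat_eq_factorial, neg_div, mul_div_cancel_left₀ v hs.ne', smul_eq_mul]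
    field_simp
  · rw [← integral_mul_comp_sq_Ioi _ hb (half_pos hs)]
    refine setIntegral_congr_fun measurableSet_Ioi fun t (ht : b < t) => ?_
    have ht0 : 0 < t := hb.trans_lt ht
    have hexp : -(s / 2 * t ^ 2 + s / 2 * a ^ 2) / s = -(t ^ 2 + a ^ 2) / 2 := by
      field_simp
    have hseries : s / 2 * a ^ 2 * (s / 2 * t ^ 2) / s ^ 2 = (a * t) ^ 2 / 4 := by
      field_simp
      norm_num
    have hpow : s / 2 * t ^ 2 / s = t / a * (a * t / 2) := by
      field_simp
    simp only [noncentralPDF_of_pos ν s _ (by positivity : 0 < s / 2 * t ^ 2), besselI_eq,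
      Nat.add_sub_cancel, hexp, hseries, hpow, mul_pow (t / a)]
    field_simp

theorem noncentralLaw_real (hs : 0 < s) {l : ℝ} (hl : 0 ≤ l) {A : Set ℝ} (hA : MeasurableSet A) :
    (noncentralLaw ν s l).real A = ∫ v in A, noncentralPDF ν s l v := by
  rw [integral_eq_lintegral_of_nonneg_ae (ae_of_all _ fun v => noncentralPDF_nonneg ν hs hl v)
    (by fun_prop), measureReal_def, noncentralLaw, withDensity_apply _ hA]

theorem phi_eq_noncentralLaw_real (hr : r ^ 2 < 1) (hz : 0 ≤ z) (hx : 0 ≤ x) :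
    phi (ν + 1) r z x = (noncentralLaw ν (1 - r ^ 2) (r ^ 2 * z)).real (Iio x) := by
  have hs : 0 < 1 - r ^ 2 := sub_pos.mpr hr
  have hl : 0 ≤ r ^ 2 * z := by positivity
  have := isProbabilityMeasure_noncentralLaw ν hs hl
  have ha : (1 - r ^ 2) / 2 * Real.sqrt (2 * z * r ^ 2 / (1 - r ^ 2)) ^ 2 = r ^ 2 * z := by
    rw [Real.sq_sqrt (by positivity)]
    field_simp
  have hb : (1 - r ^ 2) / 2 * Real.sqrt (2 * x / (1 - r ^ 2)) ^ 2 = x := by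
    rw [Real.sq_sqrt (by positivity)]
    field_simp
  rw [phi, marcumQ_eq_integral_noncentralPDF _ hs (Real.sqrt_nonneg _), ha, hb,
    ← integral_Ici_eq_integral_Ioi, ← noncentralLaw_real hs hl measurableSet_Ici,
    ← probReal_compl_eq_one_sub measurableSet_Ici, compl_Ici]

end SpecialFunctions

section VectorChannel

variable {N : ℕ} {ι : Type*} [Fintype ι] {ν : ℕ} {ρ : Fin N → ℝ} {n : Fin N}

/-- The law of the channel of port `n` given the value `z` of the reference channel. -/
def conditionalLaw (ν : ℕ) (ρ : Fin N → ℝ) (n : Fin N) (z : ℝ) : Measure ℝ :=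
  noncentralLaw ν (1 - ρ n ^ 2) (ρ n ^ 2 * z)

theorem isProbabilityMeasure_conditionalLaw (hn : ρ n ^ 2 < 1) {z : ℝ} (hz : 0 ≤ z) :
    IsProbabilityMeasure (conditionalLaw ν ρ n z) :=
  isProbabilityMeasure_noncentralLaw ν (sub_pos.mpr hn) (by positivity)

@[fun_prop]
theorem measurable_conditionalLaw_Iio {α : Type*} [MeasurableSpace α] (ν : ℕ) (ρ : Fin N → ℝ)
    (n : Fin N) {f g : α → ℝ} (hf : Measurable f) (hg : Measurable g) :
    Measurable fun a => conditionalLaw ν ρ n (f a) (Iio (g a)) := by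
  unfold conditionalLaw
  fun_prop

variable [NeZero N]

/-- The channel of port `n` as a function of the real Gaussian vectors of all the ports: the real
and the imaginary parts of the gains become coordinates indexed by a single finite type. -/
def vectorChannel (ρ : Fin N → ℝ) (n : Fin N) (w : Fin N → ι → ℝ) : ℝ :=
  if n = 0 then ∑ i, w 0 i ^ 2 else ∑ i, (Real.sqrt (1 - ρ n ^ 2) * w n i + ρ n * w 0 i) ^ 2

@[fun_prop]
theorem measurable_vectorChannel (ρ : Fin N → ℝ) (n : Fin N) :
    Measurable (vectorChannel (ι := ι) ρ n) := by
  unfold vectorChannel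
  split_ifs <;> fun_prop

theorem vectorChannel_zero_update (w : Fin N → ι → ℝ) (u : ι → ℝ) :
    vectorChannel ρ 0 (Function.update w 0 u) = ∑ i, u i ^ 2 := by
  simp [vectorChannel]

theorem vectorChannel_update_of_ne (hn : n ≠ 0) (w : Fin N → ι → ℝ) (u : ι → ℝ) :
    vectorChannel ρ n (Function.update w 0 u) =
      ∑ i, (Real.sqrt (1 - ρ n ^ 2) * w n i + ρ n * u i) ^ 2 := by
  simp [vectorChannel, hn]

theorem hasLaw_sum_affine_sq_pi {r : ℝ} (hr : r ^ 2 < 1) (hι : Fintype.card ι = 2 * (ν + 1))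
    (u : ι → ℝ) :
    HasLaw (fun v : ι → ℝ => ∑ i, (Real.sqrt (1 - r ^ 2) * v i + r * u i) ^ 2)
      (noncentralLaw ν (1 - r ^ 2) (r ^ 2 * ∑ i, u i ^ 2))
      (Measure.pi fun _ => gaussianReal 0 (1 / 2)) := by
  have hs : 0 < 1 - r ^ 2 := sub_pos.mpr hr
  have hindep : iIndepFun (fun i (v : ι → ℝ) => Real.sqrt (1 - r ^ 2) * v i + r * u i)
      (Measure.pi fun _ => gaussianReal 0 (1 / 2)) :=
    iIndepFun_pi (X := fun i v => Real.sqrt (1 - r ^ 2) * v + r * u i) fun i => by fun_prop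
  have hcoord (i : ι) : HasLaw (fun v : ι → ℝ => Real.sqrt (1 - r ^ 2) * v i + r * u i)
      (gaussianReal (r * u i) (Real.toNNReal ((1 - r ^ 2) / 2)))
      (Measure.pi fun _ => gaussianReal 0 (1 / 2)) := by
    have heval : HasLaw (fun v : ι → ℝ => v i) (gaussianReal 0 (1 / 2))
        (Measure.pi fun _ => gaussianReal 0 (1 / 2)) :=
          (measurePreserving_eval (fun _ : ι => gaussianReal 0 (1 / 2)) i).hasLaw
    convert! gaussianReal_add_const (gaussianReal_const_mul heval _) (r * u i) using 2
    · simp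
    · ext
      simp [Real.sq_sqrt hs.le, hs.le, div_eq_mul_inv]
  convert! hasLaw_sum_sq hindep hcoord (by simpa using hr) hι using 2
  · rw [Real.coe_toNNReal _ (by positivity)]
    ring
  · simp only [mul_pow, Finset.mul_sum]

theorem hasLaw_sum_sq_pi (hι : Fintype.card ι = 2 * (ν + 1)) :
    HasLaw (fun v : ι → ℝ => ∑ i, v i ^ 2) (noncentralLaw ν 1 0)
      (Measure.pi fun _ => gaussianReal 0 (1 / 2)) := by
  simpa using hasLaw_sum_affine_sq_pi (r := 0) (by simp) hι 0

variable {Ω : Type*} [MeasurableSpace Ω] {P : Measure Ω} {W : Fin N → Ω → ι → ℝ}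

theorem iIndepFun_vectorChannel_update (hindep : iIndepFun W P) (u : ι → ℝ) :
    iIndepFun (fun k ω => vectorChannel ρ k (Function.update (W · ω) 0 u)) P := by
  let g (k : Fin N) (v : ι → ℝ) : ℝ :=
    if k = 0 then ∑ i, u i ^ 2 else ∑ i, (Real.sqrt (1 - ρ k ^ 2) * v i + ρ k * u i) ^ 2
  convert! hindep.comp g fun k => by unfold g; split_ifs <;> fun_prop with k ω
  by_cases hk : k = 0
  · simp [g, hk, vectorChannel_zero_update]
  · simp [g, hk, vectorChannel_update_of_ne]

theorem hasLaw_vectorChannel_update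
    (hlaw : ∀ k, HasLaw (W k) (Measure.pi fun _ => gaussianReal 0 (1 / 2)) P)
    (hι : Fintype.card ι = 2 * (ν + 1)) (hn : n ≠ 0)
    (hρ : ρ n ^ 2 < 1) (u : ι → ℝ) :
    HasLaw (fun ω => vectorChannel ρ n (Function.update (W · ω) 0 u))
      (conditionalLaw ν ρ n (∑ i, u i ^ 2)) P := by
  simp_rw [vectorChannel_update_of_ne hn]
  exact (hasLaw_sum_affine_sq_pi hρ hι u).fun_comp (hlaw n)

theorem aemeasurable_vectorChannel_update
    (hlaw : ∀ k, HasLaw (W k) (Measure.pi fun _ => gaussianReal 0 (1 / 2)) P)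
    (n : Fin N) (u : ι → ℝ) :
    AEMeasurable (fun ω => vectorChannel ρ n (Function.update (W · ω) 0 u)) P :=
  ((measurable_vectorChannel ρ n).comp measurable_update_left).comp_aemeasurable
    (aemeasurable_pi_lambda _ fun k => (hlaw k).aemeasurable)

theorem measure_forall_vectorChannel_update_lt
    (hlaw : ∀ k, HasLaw (W k) (Measure.pi fun _ => gaussianReal 0 (1 / 2)) P)
    (hι : Fintype.card ι = 2 * (ν + 1))
    (hρ : ∀ k, k ≠ 0 → ρ k ^ 2 < 1) (hindep : iIndepFun W P) (u : ι → ℝ) (x : ℝ) :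
    P {ω | ∀ k, k ≠ 0 → vectorChannel ρ k (Function.update (W · ω) 0 u) < x} =
      ∏ k ∈ Finset.univ.filter (fun k : Fin N => k ≠ 0),
        conditionalLaw ν ρ k (∑ i, u i ^ 2) (Iio x) := by
  have hprod := measure_forall_lt_eq_prod (iIndepFun_vectorChannel_update (ρ := ρ) hindep u)
    (aemeasurable_vectorChannel_update hlaw · u) (Finset.univ.filter (fun k : Fin N => k ≠ 0)) x
  simp only [Finset.mem_filter_univ] at hprod
  rw [hprod]
  refine Finset.prod_congr rfl fun k hk => ?_
  have hk0 : k ≠ 0 := by simpa using hk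
  rw [(hasLaw_vectorChannel_update hlaw hι hk0 (hρ k hk0) u).map_eq]

theorem measure_vectorChannel_update_mem_and_forall_lt
    (hlaw : ∀ k, HasLaw (W k) (Measure.pi fun _ => gaussianReal 0 (1 / 2)) P)
    (hι : Fintype.card ι = 2 * (ν + 1))
    (hρ : ∀ k, k ≠ 0 → ρ k ^ 2 < 1) (hindep : iIndepFun W P) (hn : n ≠ 0) (u : ι → ℝ) {A : Set ℝ}
    (hA : MeasurableSet A) :
    P {ω | vectorChannel ρ n (Function.update (W · ω) 0 u) ∈ A ∧ ∀ k, k ≠ 0 → k ≠ n →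
        vectorChannel ρ k (Function.update (W · ω) 0 u) <
          vectorChannel ρ n (Function.update (W · ω) 0 u)} =
      ∫⁻ x in A, ∏ k ∈ Finset.univ.filter (fun k : Fin N => k ≠ 0 ∧ k ≠ n),
        conditionalLaw ν ρ k (∑ i, u i ^ 2) (Iio x) ∂conditionalLaw ν ρ n (∑ i, u i ^ 2) := by
  have hmax := measure_mem_and_forall_lt_eq_lintegral
    (iIndepFun_vectorChannel_update (ρ := ρ) hindep u)
    (aemeasurable_vectorChannel_update hlaw · u) (i := n)
    (s := Finset.univ.filter (fun k : Fin N => k ≠ 0 ∧ k ≠ n)) (by simp) hA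
  simp only [Finset.mem_filter_univ, and_imp] at hmax
  rw [hmax, (hasLaw_vectorChannel_update hlaw hι hn (hρ n hn) u).map_eq]
  refine lintegral_congr fun x => Finset.prod_congr rfl fun k hk => ?_
  have hk0 : k ≠ 0 := (Finset.mem_filter_univ k).mp hk |>.1
  rw [(hasLaw_vectorChannel_update hlaw hι hk0 (hρ k hk0) u).map_eq]

end VectorChannel

section Selection

variable {N : ℕ} [NeZero N] {ι : Type*} [Fintype ι] {ν : ℕ} {ρ : Fin N → ℝ} {n : Fin N}

/-- The density in `(z, x)` of the joint law of the reference channel `z` and the channel `x` of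
port `n ≠ 0`, on the event that the channels of all the ports other than `0` and `n` are smaller
than `x`. -/
def jointDensity (ν : ℕ) (ρ : Fin N → ℝ) (n : Fin N) (z x : ℝ) : ℝ≥0∞ :=
  ENNReal.ofReal (noncentralPDF ν 1 0 z) *
    ENNReal.ofReal (noncentralPDF ν (1 - ρ n ^ 2) (ρ n ^ 2 * z) x) *
      ∏ k ∈ Finset.univ.filter (fun k : Fin N => k ≠ 0 ∧ k ≠ n), conditionalLaw ν ρ k z (Iio x)

/-- The density of the channel of port `n` on the event that port `n` is selected, in terms of
noncentral chi-squared laws instead of special functions. -/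
def selectionDensity (ν : ℕ) (ρ : Fin N → ℝ) (n : Fin N) (x : ℝ) : ℝ≥0∞ :=
  if n = 0 then ENNReal.ofReal (noncentralPDF ν 1 0 x) *
    ∏ k ∈ Finset.univ.filter (fun k : Fin N => k ≠ 0), conditionalLaw ν ρ k x (Iio x)
  else ∫⁻ z in Iio x, jointDensity ν ρ n z x

@[fun_prop]
theorem measurable_jointDensity {α : Type*} [MeasurableSpace α] (ν : ℕ) (ρ : Fin N → ℝ)
    (n : Fin N) {f g : α → ℝ} (hf : Measurable f) (hg : Measurable g) :
    Measurable fun a => jointDensity ν ρ n (f a) (g a) := by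
  unfold jointDensity
  fun_prop

theorem selectionDensity_zero (ν : ℕ) (ρ : Fin N → ℝ) (x : ℝ) :
    selectionDensity ν ρ 0 x = ENNReal.ofReal (noncentralPDF ν 1 0 x) *
      ∏ k ∈ Finset.univ.filter (fun k : Fin N => k ≠ 0), conditionalLaw ν ρ k x (Iio x) :=
  if_pos rfl

theorem selectionDensity_of_ne (ν : ℕ) (ρ : Fin N → ℝ) (hn : n ≠ 0) (x : ℝ) :
    selectionDensity ν ρ n x = ∫⁻ z in Iio x, jointDensity ν ρ n z x :=
  if_neg hn

theorem measurable_selectionDensity (ν : ℕ) (ρ : Fin N → ℝ) (n : Fin N) :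
    Measurable (selectionDensity ν ρ n) := by
  rcases eq_or_ne n 0 with rfl | hn
  · simp only [funext (selectionDensity_zero ν ρ)]
    fun_prop
  simp only [funext (selectionDensity_of_ne ν ρ hn)]
  exact measurable_setLIntegral (by fun_prop) (measurableSet_lt measurable_snd measurable_fst)

variable {Ω : Type*} [MeasurableSpace Ω] {P : Measure Ω} {W : Fin N → Ω → ι → ℝ}

theorem measure_eq_lintegral_noncentralPDF
    (hlaw : ∀ k, HasLaw (W k) (Measure.pi fun _ => gaussianReal 0 (1 / 2)) P)
    (hι : Fintype.card ι = 2 * (ν + 1)) (hindep : iIndepFun W P) {S : Set (Fin N → ι → ℝ)}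
    (hS : MeasurableSet S) {f : ℝ → ℝ≥0∞} (hf : Measurable f)
    (hSf : ∀ u : ι → ℝ, P {ω | Function.update (W · ω) 0 u ∈ S} = f (∑ i, u i ^ 2)) :
    P {ω | (W · ω) ∈ S} = ∫⁻ z, ENNReal.ofReal (noncentralPDF ν 1 0 z) * f z := by
  rw [measure_eq_lintegral_update (fun k => (hlaw k).aemeasurable) hindep 0 hS, (hlaw 0).map_eq]
  simp_rw [hSf]
  rw [(hasLaw_sum_sq_pi hι).lintegral_comp hf.aemeasurable, noncentralLaw,
    lintegral_withDensity_eq_lintegral_mul _ (by fun_prop) hf]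
  rfl

theorem measurableSet_vectorChannel_mem_and_forall_lt (ρ : Fin N → ℝ) (n : Fin N) {A : Set ℝ}
    (hA : MeasurableSet A) :
    MeasurableSet {w : Fin N → ι → ℝ |
      vectorChannel ρ n w ∈ A ∧ ∀ k, k ≠ n → vectorChannel ρ k w < vectorChannel ρ n w} := by
  have hlt (k : Fin N) : MeasurableSet {w : Fin N → ι → ℝ |
      k ≠ n → vectorChannel ρ k w < vectorChannel ρ n w} :=
    .imp (.const _) (measurableSet_lt (by fun_prop) (by fun_prop))
  have hmem := measurable_vectorChannel (ι := ι) ρ n hA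
  convert! hmem.inter (MeasurableSet.iInter hlt) using 1
  ext w
  simp

theorem measure_vectorChannel_zero_mem_and_forall_lt
    (hlaw : ∀ k, HasLaw (W k) (Measure.pi fun _ => gaussianReal 0 (1 / 2)) P)
    (hι : Fintype.card ι = 2 * (ν + 1)) (hρ : ∀ k, k ≠ 0 → ρ k ^ 2 < 1) (hindep : iIndepFun W P)
    {A : Set ℝ} (hA : MeasurableSet A) :
    P {ω | vectorChannel ρ 0 (W · ω) ∈ A ∧
        ∀ k, k ≠ 0 → vectorChannel ρ k (W · ω) < vectorChannel ρ 0 (W · ω)} =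
      ∫⁻ x in A, selectionDensity ν ρ 0 x := by
  have hf : Measurable (A.indicator fun z => ∏ k ∈ Finset.univ.filter (fun k : Fin N => k ≠ 0),
    conditionalLaw ν ρ k z (Iio z)) := Measurable.indicator (by fun_prop) hA
  refine (measure_eq_lintegral_noncentralPDF hlaw hι hindep
    (measurableSet_vectorChannel_mem_and_forall_lt ρ 0 hA) hf fun u => ?_).trans ?_
  · simp only [mem_ofPred_eq, vectorChannel_zero_update]
    by_cases hu : ∑ i, u i ^ 2 ∈ A
    · simp only [hu, true_and, indicator_of_mem,
        measure_forall_vectorChannel_update_lt hlaw hι hρ hindep u]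
    · simp [hu]
  · rw [← lintegral_indicator hA]
    refine lintegral_congr fun x => ?_
    by_cases hx : x ∈ A <;> simp [hx, selectionDensity_zero]

theorem measure_vectorChannel_mem_and_forall_lt_of_ne
    (hlaw : ∀ k, HasLaw (W k) (Measure.pi fun _ => gaussianReal 0 (1 / 2)) P)
    (hι : Fintype.card ι = 2 * (ν + 1)) (hρ : ∀ k, k ≠ 0 → ρ k ^ 2 < 1) (hindep : iIndepFun W P)
    (hn : n ≠ 0) {A : Set ℝ} (hA : MeasurableSet A) :
    P {ω | vectorChannel ρ n (W · ω) ∈ A ∧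
        ∀ k, k ≠ n → vectorChannel ρ k (W · ω) < vectorChannel ρ n (W · ω)} =
      ∫⁻ x in A, selectionDensity ν ρ n x := by
  have hcond (z : ℝ) : ∫⁻ x in A ∩ Ioi z,
      ∏ k ∈ Finset.univ.filter (fun k : Fin N => k ≠ 0 ∧ k ≠ n),
        conditionalLaw ν ρ k z (Iio x) ∂conditionalLaw ν ρ n z =
      ∫⁻ x in A ∩ Ioi z, ENNReal.ofReal (noncentralPDF ν (1 - ρ n ^ 2) (ρ n ^ 2 * z) x) *
        ∏ k ∈ Finset.univ.filter (fun k : Fin N => k ≠ 0 ∧ k ≠ n),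
          conditionalLaw ν ρ k z (Iio x) := by
    rw [conditionalLaw, noncentralLaw, restrict_withDensity (hA.inter measurableSet_Ioi),
      lintegral_withDensity_eq_lintegral_mul _ (by fun_prop) (by fun_prop)]
    rfl
  have hf : Measurable fun z => ∫⁻ x in A ∩ Ioi z,
      ENNReal.ofReal (noncentralPDF ν (1 - ρ n ^ 2) (ρ n ^ 2 * z) x) *
        ∏ k ∈ Finset.univ.filter (fun k : Fin N => k ≠ 0 ∧ k ≠ n),
          conditionalLaw ν ρ k z (Iio x) :=
    measurable_setLIntegral (by fun_prop)
      ((measurable_snd hA).inter (measurableSet_lt measurable_fst measurable_snd))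
  refine (measure_eq_lintegral_noncentralPDF hlaw hι hindep
    (measurableSet_vectorChannel_mem_and_forall_lt ρ n hA) hf fun u => ?_).trans ?_
  · rw [← hcond, ← measure_vectorChannel_update_mem_and_forall_lt hlaw hι hρ hindep hn u
      (hA.inter measurableSet_Ioi)]
    congr 1 with ω
    simp only [mem_ofPred_eq, mem_inter_iff, mem_Ioi,
      ← vectorChannel_zero_update (ρ := ρ) (W · ω) u]
    grind
  · simp_rw [selectionDensity_of_ne ν ρ hn]
    rw [← lintegral_inter_Ioi_swap (by fun_prop)]
    refine lintegral_congr fun z => ?_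
    rw [← lintegral_const_mul' _ _ ENNReal.ofReal_ne_top]
    simp only [jointDensity, mul_assoc]

theorem measure_vectorChannel_mem_and_forall_lt
    (hlaw : ∀ k, HasLaw (W k) (Measure.pi fun _ => gaussianReal 0 (1 / 2)) P)
    (hι : Fintype.card ι = 2 * (ν + 1)) (hρ : ∀ k, k ≠ 0 → ρ k ^ 2 < 1) (hindep : iIndepFun W P)
    (n : Fin N) {A : Set ℝ} (hA : MeasurableSet A) :
    P {ω | vectorChannel ρ n (W · ω) ∈ A ∧
        ∀ k, k ≠ n → vectorChannel ρ k (W · ω) < vectorChannel ρ n (W · ω)} =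
      ∫⁻ x in A, selectionDensity ν ρ n x := by
  rcases eq_or_ne n 0 with rfl | hn
  · exact measure_vectorChannel_zero_mem_and_forall_lt hlaw hι hρ hindep hA
  · exact measure_vectorChannel_mem_and_forall_lt_of_ne hlaw hι hρ hindep hn hA

end Selection

section Density

variable {N : ℕ} [NeZero N] {ν : ℕ} {ρ : Fin N → ℝ} {n : Fin N} {x z : ℝ}

theorem prod_conditionalLaw_Iio_le_one (hρ : ∀ k, k ≠ 0 → ρ k ^ 2 < 1) (hz : 0 ≤ z) (x : ℝ) :
    ∏ k ∈ Finset.univ.filter (fun k : Fin N => k ≠ 0 ∧ k ≠ n),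
      conditionalLaw ν ρ k z (Iio x) ≤ 1 := by
  refine Finset.prod_le_one' fun k hk => ?_
  have := isProbabilityMeasure_conditionalLaw (ν := ν)
    (hρ k ((Finset.mem_filter_univ k).mp hk).1) hz
  exact prob_le_one

theorem jointDensity_of_nonpos (hz : z ≤ 0) : jointDensity ν ρ n z x = 0 := by
  simp [jointDensity, noncentralPDF_of_nonpos ν 1 0 hz]

theorem jointDensity_pos (hρ : ∀ k, k ≠ 0 → ρ k ^ 2 < 1) (hn : n ≠ 0) (hz : 0 < z) (hx : 0 < x) :
    0 < jointDensity ν ρ n z x := by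
  refine ENNReal.mul_pos (mul_ne_zero ?_ ?_) (Finset.prod_ne_zero_iff.mpr fun k hk => ?_)
  · exact (ENNReal.ofReal_pos.mpr (noncentralPDF_pos ν one_pos le_rfl hz)).ne'
  · exact (ENNReal.ofReal_pos.mpr
      (noncentralPDF_pos ν (sub_pos.mpr (hρ n hn)) (by positivity) hx)).ne'
  · exact (noncentralLaw_Iio_pos (sub_pos.mpr (hρ k ((Finset.mem_filter_univ k).mp hk).1))
      (by positivity) hx).ne'

theorem selectionDensity_of_nonpos (hx : x ≤ 0) : selectionDensity ν ρ n x = 0 := by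
  rcases eq_or_ne n 0 with rfl | hn
  · simp [selectionDensity_zero, noncentralPDF_of_nonpos ν 1 0 hx]
  · rw [selectionDensity_of_ne ν ρ hn, setLIntegral_congr_fun measurableSet_Iio fun z hz =>
      jointDensity_of_nonpos (hz.le.trans hx), lintegral_zero]

theorem selectionDensity_pos (hρ : ∀ k, k ≠ 0 → ρ k ^ 2 < 1) (n : Fin N) (hx : 0 < x) :
    0 < selectionDensity ν ρ n x := by
  rcases eq_or_ne n 0 with rfl | hn
  · rw [selectionDensity_zero]
    refine ENNReal.mul_pos ?_ (Finset.prod_ne_zero_iff.mpr fun k hk => ?_)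
    · exact (ENNReal.ofReal_pos.mpr (noncentralPDF_pos ν one_pos le_rfl hx)).ne'
    · exact (noncentralLaw_Iio_pos (sub_pos.mpr (hρ k ((Finset.mem_filter_univ k).mp hk)))
        (by positivity) hx).ne'
  · rw [selectionDensity_of_ne ν ρ hn, setLIntegral_pos_iff (by fun_prop)]
    refine (by simpa using hx : 0 < volume (Ioo 0 x)).trans_le
      (measure_mono fun z hz => ⟨(jointDensity_pos hρ hn hz.1 hx).ne', hz.2⟩)

theorem lintegral_selectionDensity_pos (ν : ℕ) (hρ : ∀ k, k ≠ 0 → ρ k ^ 2 < 1) (n : Fin N) :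
    0 < ∫⁻ x, selectionDensity ν ρ n x := by
  rw [lintegral_pos_iff_support (measurable_selectionDensity ν ρ n)]
  exact (by simp : 0 < volume (Ioi (0 : ℝ))).trans_le
    (measure_mono fun t ht => (selectionDensity_pos hρ n ht).ne')

theorem exists_jointDensity_le (hρ : ∀ k, k ≠ 0 → ρ k ^ 2 < 1) (hn : n ≠ 0) (x : ℝ) :
    ∃ C : ℝ, ∀ z < x,
      jointDensity ν ρ n z x ≤ ENNReal.ofReal (noncentralPDF ν 1 0 z) * ENNReal.ofReal C := by
  refine ⟨(x / (1 - ρ n ^ 2)) ^ ν / (1 - ρ n ^ 2) *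
    besselSeries ν (ρ n ^ 2 * x * x / (1 - ρ n ^ 2) ^ 2), fun z hzx => ?_⟩
  rcases le_or_gt z 0 with hz | hz
  · simp [jointDensity_of_nonpos hz]
  rw [jointDensity]
  refine mul_le_of_le_of_le_one ?_ (prod_conditionalLaw_Iio_le_one hρ hz.le x)
  gcongr
  exact noncentralPDF_le (sub_pos.mpr (hρ n hn)) (by positivity) (by gcongr) (hz.trans hzx)

theorem setLIntegral_jointDensity_ne_top (hρ : ∀ k, k ≠ 0 → ρ k ^ 2 < 1) (hn : n ≠ 0) (x : ℝ) :
    ∫⁻ z in Iio x, jointDensity ν ρ n z x ≠ ∞ := by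
  obtain ⟨C, hC⟩ := exists_jointDensity_le (ν := ν) hρ hn x
  have hmass : ∫⁻ z, ENNReal.ofReal (noncentralPDF ν 1 0 z) = 1 := by
    have := (isProbabilityMeasure_noncentralLaw ν one_pos le_rfl).measure_univ
    rwa [noncentralLaw, withDensity_apply _ .univ, Measure.restrict_univ] at this
  refine ne_top_of_le_ne_top ENNReal.ofReal_ne_top (b := ENNReal.ofReal C) ?_
  calc ∫⁻ z in Iio x, jointDensity ν ρ n z x
      ≤ ∫⁻ z in Iio x, ENNReal.ofReal (noncentralPDF ν 1 0 z) * ENNReal.ofReal C :=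
        setLIntegral_mono (by fun_prop) hC
    _ ≤ ∫⁻ z, ENNReal.ofReal (noncentralPDF ν 1 0 z) * ENNReal.ofReal C :=
        setLIntegral_le_lintegral _ _
    _ = ENNReal.ofReal C := by
        rw [lintegral_mul_const' _ _ ENNReal.ofReal_ne_top, hmass, one_mul]

theorem toReal_jointDensity (hρ : ∀ k, k ≠ 0 → ρ k ^ 2 < 1) (hn : n ≠ 0) (hz : 0 < z)
    (hx : 0 < x) :
    (jointDensity ν ρ n z x).toReal =
      1 / (Real.Gamma (ν + 1 : ℕ) * (1 - ρ n ^ 2)) * integrandOther (ν + 1) ρ n x z := by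
  have hphi : (∏ k ∈ Finset.univ.filter (fun k : Fin N => k ≠ 0 ∧ k ≠ n),
      conditionalLaw ν ρ k z (Iio x)).toReal =
      ∏ k ∈ Finset.univ.filter (fun k : Fin N => k ≠ 0 ∧ k ≠ n), phi (ν + 1) (ρ k) z x := by
    rw [ENNReal.toReal_prod]
    exact Finset.prod_congr rfl fun k hk => (phi_eq_noncentralLaw_real
      (hρ k ((Finset.mem_filter_univ k).mp hk).1) hz.le hx.le).symm
  rw [jointDensity, ENNReal.toReal_mul, ENNReal.toReal_mul, hphi,
    ENNReal.toReal_ofReal (noncentralPDF_nonneg ν one_pos le_rfl z),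
    ENNReal.toReal_ofReal (noncentralPDF_nonneg ν (sub_pos.mpr (hρ n hn)) (by positivity) x),
    noncentralPDF_mul_eq (hρ n hn) hz hx, integrandOther]
  ring

theorem intervalIntegrable_integrandOther (hρ : ∀ k, k ≠ 0 → ρ k ^ 2 < 1) (hn : n ≠ 0)
    (hx : 0 < x) : IntervalIntegrable (integrandOther (ν + 1) ρ n x) volume 0 x := by
  have hs : 0 < 1 - ρ n ^ 2 := sub_pos.mpr (hρ n hn)
  have : 0 < Real.Gamma (ν + 1 : ℕ) := Real.Gamma_pos_of_pos (by positivity)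
  have hjoint : IntegrableOn (fun z => (jointDensity ν ρ n z x).toReal) (Ioo 0 x) :=
    IntegrableOn.mono_set (integrable_toReal_of_lintegral_ne_top (by fun_prop)
      (setLIntegral_jointDensity_ne_top hρ hn x)) Ioo_subset_Iio_self
  rw [intervalIntegrable_iff_integrableOn_Ioo_of_le hx.le]
  refine IntegrableOn.congr_fun (hjoint.const_mul (Real.Gamma (ν + 1 : ℕ) * (1 - ρ n ^ 2)))
    (fun z hz => ?_) measurableSet_Ioo
  simp only [toReal_jointDensity hρ hn hz.1 hx]
  field_simp

theorem densityFirst_eq_toReal (hρ : ∀ k, k ≠ 0 → ρ k ^ 2 < 1) (hx : 0 < x) :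
    densityFirst (ν + 1) ρ x = (selectionDensity ν ρ 0 x).toReal := by
  rw [selectionDensity_zero, ENNReal.toReal_mul, ENNReal.toReal_prod,
    ENNReal.toReal_ofReal (noncentralPDF_nonneg ν one_pos le_rfl x), noncentralPDF_one_zero hx,
    densityFirst, Nat.add_sub_cancel]
  congr 1
  exact Finset.prod_congr rfl fun k hk => phi_eq_noncentralLaw_real
    (hρ k ((Finset.mem_filter_univ k).mp hk)) hx.le hx.le

theorem densityOther_eq_toReal (hρ : ∀ k, k ≠ 0 → ρ k ^ 2 < 1) (hn : n ≠ 0) (hx : 0 < x) :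
    densityOther (ν + 1) ρ n x = (selectionDensity ν ρ n x).toReal := by
  have hfin : ∀ᵐ z ∂volume.restrict (Iio x), jointDensity ν ρ n z x < ∞ :=
    ae_lt_top (by fun_prop) (setLIntegral_jointDensity_ne_top hρ hn x)
  have hzero : ∀ z ∈ Iio x \ Ioo 0 x, (jointDensity ν ρ n z x).toReal = 0 := fun z hz => by
    rw [jointDensity_of_nonpos (not_lt.mp fun h => hz.2 ⟨h, hz.1⟩), ENNReal.toReal_zero]
  rw [densityOther, selectionDensity_of_ne ν ρ hn, ← integral_toReal (by fun_prop) hfin,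
    setIntegral_eq_of_subset_of_forall_sdiff_eq_zero measurableSet_Iio Ioo_subset_Iio_self hzero,
    intervalIntegral.integral_of_le hx.le, integral_Ioc_eq_integral_Ioo, ← integral_const_mul]
  exact setIntegral_congr_fun measurableSet_Ioo fun z hz =>
    (toReal_jointDensity hρ hn hz.1 hx).symm

theorem density_eq_toReal (hρ : ∀ k, k ≠ 0 → ρ k ^ 2 < 1) (n : Fin N) (x : ℝ) :
    density (ν + 1) ρ n x = (selectionDensity ν ρ n x).toReal := by
  unfold density
  split_ifs with hx hn
  · rw [selectionDensity_of_nonpos hx, ENNReal.toReal_zero]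
  · rw [hn, densityFirst_eq_toReal hρ (not_le.mp hx)]
  · exact densityOther_eq_toReal hρ hn (not_le.mp hx)

end Density

section Channel

variable {Ω : Type*} {N m : ℕ}

/-- The real Gaussian vector underlying port `n`: the real parts of the gains followed by the
imaginary parts. -/
def portVector (x y : Fin N → Fin m → Ω → ℝ) (n : Fin N) (ω : Ω) (i : Fin m ⊕ Fin m) : ℝ :=
  Sum.elim (x n) (y n) i ω

theorem channel_eq_vectorChannel [NeZero N] (ρ : Fin N → ℝ) (x y : Fin N → Fin m → Ω → ℝ)
    (n : Fin N) (ω : Ω) : channel ρ x y n ω = vectorChannel ρ n (portVector x y · ω) := by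
  have hnorm (a b : ℝ) : ‖(a : ℂ) + Complex.I * (b : ℂ)‖ ^ 2 = a ^ 2 + b ^ 2 := by
    rw [← Complex.normSq_eq_norm_sq, mul_comm, Complex.normSq_add_mul_I]
  simp only [channel, gain, vectorChannel, portVector, Fintype.sum_sum_type, Sum.elim_inl,
    Sum.elim_inr, ← Finset.sum_add_distrib]
  split_ifs <;> simp only [hnorm]

variable [MeasurableSpace Ω] {P : Measure Ω} {x y : Fin N → Fin m → Ω → ℝ}

theorem iIndepFun_elim_portVector (hindep : iIndepFun
      (Sum.elim (fun p : Fin N × Fin m => x p.1 p.2) (fun p : Fin N × Fin m => y p.1 p.2)) P) :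
    iIndepFun (fun (p : Fin N × (Fin m ⊕ Fin m)) ω => portVector x y p.1 ω p.2) P := by
  convert! hindep.precomp (Equiv.prodSumDistrib (Fin N) (Fin m) (Fin m)).injective with p
  rcases p with ⟨n, k | k⟩ <;> rfl

theorem hasLaw_portVector_apply (hx : ∀ n k, HasLaw (x n k) (gaussianReal 0 (1 / 2)) P)
    (hy : ∀ n k, HasLaw (y n k) (gaussianReal 0 (1 / 2)) P) (n : Fin N) (i : Fin m ⊕ Fin m) :
    HasLaw (fun ω => portVector x y n ω i) (gaussianReal 0 (1 / 2)) P := by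
  rcases i with k | k
  exacts [hx n k, hy n k]

theorem iIndepFun_portVector (hx : ∀ n k, HasLaw (x n k) (gaussianReal 0 (1 / 2)) P)
    (hy : ∀ n k, HasLaw (y n k) (gaussianReal 0 (1 / 2)) P)
    (hindep : iIndepFun
      (Sum.elim (fun p : Fin N × Fin m => x p.1 p.2) (fun p : Fin N × Fin m => y p.1 p.2)) P) :
    iIndepFun (portVector x y) P :=
  iIndepFun_curry (fun n i => (hasLaw_portVector_apply hx hy n i).aemeasurable)
    (iIndepFun_elim_portVector hindep)

theorem hasLaw_portVector (hx : ∀ n k, HasLaw (x n k) (gaussianReal 0 (1 / 2)) P)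
    (hy : ∀ n k, HasLaw (y n k) (gaussianReal 0 (1 / 2)) P)
    (hindep : iIndepFun
      (Sum.elim (fun p : Fin N × Fin m => x p.1 p.2) (fun p : Fin N × Fin m => y p.1 p.2)) P)
    (n : Fin N) :
    HasLaw (portVector x y n) (Measure.pi fun _ => gaussianReal 0 (1 / 2)) P :=
  ((iIndepFun_elim_portVector hindep).precomp (Prod.mk_right_injective n)).hasLaw_pi
    (hasLaw_portVector_apply hx hy n)

variable [NeZero N] {ρ : Fin N → ℝ}

theorem aemeasurable_channel (hx : ∀ n k, AEMeasurable (x n k) P)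
    (hy : ∀ n k, AEMeasurable (y n k) P) (n : Fin N) : AEMeasurable (channel ρ x y n) P := by
  refine Finset.aemeasurable_fun_sum _ fun k _ => ?_
  unfold gain
  split_ifs <;> fun_prop

theorem map_channel_restrict_selected {ν : ℕ} (hρ : ∀ k, k ≠ 0 → ρ k ^ 2 < 1)
    {x y : Fin N → Fin (ν + 1) → Ω → ℝ}
    (hx : ∀ n k, HasLaw (x n k) (gaussianReal 0 (1 / 2)) P)
    (hy : ∀ n k, HasLaw (y n k) (gaussianReal 0 (1 / 2)) P)
    (hindep : iIndepFun (Sum.elim (fun p : Fin N × Fin (ν + 1) => x p.1 p.2)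
      (fun p : Fin N × Fin (ν + 1) => y p.1 p.2)) P) (n : Fin N) :
    (P.restrict (selected ρ x y n)).map (channel ρ x y n) =
      volume.withDensity (selectionDensity ν ρ n) := by
  have hae := aemeasurable_channel (ρ := ρ) (fun n k => (hx n k).aemeasurable)
    (fun n k => (hy n k).aemeasurable) n
  have hι : Fintype.card (Fin (ν + 1) ⊕ Fin (ν + 1)) = 2 * (ν + 1) := by
    rw [Fintype.card_sum, Fintype.card_fin, two_mul]
  ext A hA
  rw [Measure.map_apply_of_aemeasurable hae.restrict hA,
    Measure.restrict_apply₀ (hae.restrict.nullMeasurableSet_preimage hA), withDensity_apply _ hA,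
    ← measure_vectorChannel_mem_and_forall_lt (hasLaw_portVector hx hy hindep) hι hρ
      (iIndepFun_portVector hx hy hindep) n hA]
  simp only [← channel_eq_vectorChannel]
  rfl

end Channel

end

end FluidAntenna

theorem proposition2 {Ω : Type*} [MeasurableSpace Ω] (P : Measure Ω) [IsProbabilityMeasure P]
    (N : ℕ) [NeZero N] (m : ℕ) (hm : 1 ≤ m)
    (ρ : Fin N → ℝ) (hρ : ∀ n, n ≠ 0 → |ρ n| < 1)
    (x y : Fin N → Fin m → Ω → ℝ)
    (hx : ∀ n k, HasLaw (x n k) (gaussianReal 0 (1 / 2)) P)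
    (hy : ∀ n k, HasLaw (y n k) (gaussianReal 0 (1 / 2)) P)
    (hindep : iIndepFun
      (Sum.elim (fun p : Fin N × Fin m => x p.1 p.2) (fun p : Fin N × Fin m => y p.1 p.2)) P)
    (n : Fin N) :
    -- the expression is a genuine integrable nonnegative function
    (n ≠ 0 → ∀ t : ℝ, 0 < t → IntervalIntegrable (integrandOther m ρ n t) volume 0 t) ∧
    (∀ t, 0 ≤ density m ρ n t) ∧
    Integrable (density m ρ n) ∧
    -- it is the density of the channel at port `n` on the event that port `n` is selected
    (P.restrict (selected ρ x y n)).map (channel ρ x y n) =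
      volume.withDensity (fun t => ENNReal.ofReal (density m ρ n t)) ∧
    -- its total mass is the (positive) selection probability
    0 < P.real (selected ρ x y n) ∧
    P.real (selected ρ x y n) = ∫ t, density m ρ n t ∧
    -- divided by it, it is the density under the conditional probability measure
    (ProbabilityTheory.cond P (selected ρ x y n)).map (channel ρ x y n) =
      volume.withDensity (fun t => ENNReal.ofReal
        (density m ρ n t / P.real (selected ρ x y n))) := by
  obtain ⟨ν, rfl⟩ := Nat.exists_eq_add_of_le' hm
  have hρ' (k : Fin N) (hk : k ≠ 0) : ρ k ^ 2 < 1 := (sq_lt_one_iff_abs_lt_one _).mpr (hρ k hk)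
  have hdens : density (ν + 1) ρ n = fun t => (selectionDensity ν ρ n t).toReal :=
    funext (density_eq_toReal hρ' n)
  have hmeas : Measurable (selectionDensity ν ρ n) := measurable_selectionDensity ν ρ n
  have hsel := map_channel_restrict_selected hρ' hx hy hindep n
  have hmass : ∫⁻ t, selectionDensity ν ρ n t = P (selected ρ x y n) :=
    lintegral_eq_of_map_restrict_eq_withDensity (aemeasurable_channel
      (fun n k => (hx n k).aemeasurable) (fun n k => (hy n k).aemeasurable) n) hsel
  have hfin : ∫⁻ t, selectionDensity ν ρ n t ≠ ∞ := hmass ▸ measure_ne_top _ _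
  have hpos : 0 < P.real (selected ρ x y n) :=
    ENNReal.toReal_pos (hmass ▸ (lintegral_selectionDensity_pos ν hρ' n).ne') (measure_ne_top _ _)
  rw [← withDensity_ofReal_toReal hmeas.aemeasurable hfin] at hsel
  rw [hdens]
  refine ⟨fun hn t ht => intervalIntegrable_integrandOther hρ' hn ht,
    fun t => ENNReal.toReal_nonneg, integrable_toReal_of_lintegral_ne_top hmeas.aemeasurable hfin,
    hsel, hpos, ?_, map_cond_eq_withDensity hmeas.ennreal_toReal hsel hpos⟩
  rw [integral_toReal hmeas.aemeasurable (ae_lt_top hmeas hfin), hmass, measureReal_def]
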